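/- All rings are commutative. For a ring $S$ and $S$-modules $M,N$, let $\mathrm{Ex}^n_S(M,N)$ ($n=1,2$) be the set of Yoneda classes of exact sequences $0\to N\to T_{n-1}\to\cdots\to T_0\to M\to 0$ of $S$-modules, for the equivalence relation generated by morphisms of such sequences which are the identity on $N$ and $M$. For a ring map $A\to B$ and a $B$-module $M$, let $\mathrm{Exal}_A(B,M)$ be the set of classes of infinitesimal extensions $0\to M\xrightarrow{i}E\xrightarrow{p}B\to 0$ (exact, with $p$ a homomorphism of $A$-algebras and $e\cdot i(m)=i(p(e)m)$), two of them being equivalent if there is an $A$-algebra map between the middle terms inducing the identity on $M$ and $B$. Let $A\to R\xrightarrow{\pi}B\xrightarrow{q}C$ be ring homomorphisms with $\pi$ and $q$ surjective, let $I=\ker\pi$, and let $N$ be a $C$-module. - Mehta's map $\varphi:\mathrm{Ex}^1_R(B,C)\to\mathrm{Ex}^2_B(N,N)$: for $0\to K\to F\to N\to0$ an exact sequence of $R$-modules with $F$ projective and $[\xi]=[0\to C\to T\to B\to0]$, put $\varphi[\xi]=[\partial_*\theta]$, the pushout of $\theta=(0\to\mathrm{Tor}_1^R(B,N)\to B\otimes_RK\to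 B\otimes_RF\to B\otimes_RN=N\to0)$ along the connecting homomorphism $\partial:\mathrm{Tor}^R_1(B,N)\to C\otimes_RN=N$ of $\xi$. - The map $\psi:\mathrm{Exal}_A(B,C)\to\mathrm{Ex}^2_B(N,N)$: for $[\eta]=[0\to C\to E\to B\to0]$ and $0\to K\to F\to N\to0$ an exact sequence of $E$-modules with $F$ projective, put $\psi[\eta]=[\partial_*\vartheta]$, the pushout of $\vartheta=(0\to\mathrm{Tor}_1^E(B,N)\to B\otimes_EK\to B\otimes_EF\to B\otimes_E N=N\to0)$ along the connecting homomorphism $\partial:\mathrm{Tor}_1^E(B,N)\to C\otimes_EN=N$ of $\eta$. - The Jacobi–Zariski map $\alpha:\mathrm{Ex}^1_R(B,C)\to\mathrm{Exal}_A(B,C)$: for $[\xi]=[0\to C\to T\to B\to0]$, lift $\pi$ to an $R$-linear map $R\to T$, let $g:I\to C$ be the induced map, and put $\alpha[\xi]=[0\to C\to C\oplus_IR\to B\to0]$, the pushout of $0\to I\to R\to B\to 0$ along $g$, with multiplication $(c_1,r_1)(c_2,r_2)=(r_1c_2+r_2c_1,r_1r_2)$ and with the $A$-algebra structure through $A\to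 R$. These maps are well defined: they do not depend on the choices made. **Theorem.** $\varphi=\psi\circ\alpha$. In particular, if $A\to B$ is surjective, then, taking $R=A$, the map $\alpha:\mathrm{Ex}^1_A(B,C)\to\mathrm{Exal}_A(B,C)$ is bijective and Mehta's map $\varphi:\mathrm{Ex}^1_A(B,C)\to\mathrm{Ex}^2_B(N,N)$ equals $\psi\circ\alpha$, so that $\psi$ recovers Mehta's map. -/

import Mathlib

open TensorProduct Function

universe u

namespace MehtaPsi

/-! ### Yoneda extensions of modules of length one and two -/

/-- A `1`-extension `0 → N → T → M → 0` of the `R`-module `M` by the `R`-module `N`. -/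
structure OneExtension (R M N : Type u) [CommRing R] [AddCommGroup M] [Module R M]
    [AddCommGroup N] [Module R N] where
  T : Type u
  [addCommGroup : AddCommGroup T]
  [module : Module R T]
  i : N →ₗ[R] T
  p : T →ₗ[R] M
  i_injective : Injective i
  exact : Exact i p
  p_surjective : Surjective p

attribute [instance] OneExtension.addCommGroup OneExtension.module

/-- A `2`-extension `0 → N → T₁ → T₀ → M → 0` of the `B`-module `M` by the `B`-module `N`. -/
structure TwoExtension (B M N : Type u) [CommRing B] [AddCommGroup M] [Module B M]
    [AddCommGroup N] [Module B N] where
  T₁ : Type u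
  T₀ : Type u
  [addCommGroup₁ : AddCommGroup T₁]
  [module₁ : Module B T₁]
  [addCommGroup₀ : AddCommGroup T₀]
  [module₀ : Module B T₀]
  i : N →ₗ[B] T₁
  d : T₁ →ₗ[B] T₀
  p : T₀ →ₗ[B] M
  i_injective : Injective i
  exact₁ : Exact i d
  exact₀ : Exact d p
  p_surjective : Surjective p

attribute [instance] TwoExtension.addCommGroup₁ TwoExtension.module₁
  TwoExtension.addCommGroup₀ TwoExtension.module₀

section Yoneda

variable {B M N : Type u} [CommRing B] [AddCommGroup M] [Module B M] [AddCommGroup N] [Module B N]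

/-- Two `1`-extensions are directly related if there is a morphism between them which is the
identity on both ends. -/
def OneExtension.DirectlyRelated (ξ ζ : OneExtension B M N) : Prop :=
  ∃ u : ξ.T →ₗ[B] ζ.T, u ∘ₗ ξ.i = ζ.i ∧ ζ.p ∘ₗ u = ξ.p

/-- Two `2`-extensions are directly related if there is a morphism between them which is the
identity on both ends. -/
def TwoExtension.DirectlyRelated (ξ ζ : TwoExtension B M N) : Prop :=
  ∃ (u₁ : ξ.T₁ →ₗ[B] ζ.T₁) (u₀ : ξ.T₀ →ₗ[B] ζ.T₀),
    u₁ ∘ₗ ξ.i = ζ.i ∧ ζ.d ∘ₗ u₁ = u₀ ∘ₗ ξ.d ∧ ζ.p ∘ₗ u₀ = ξ.p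

variable (B M N) in
/-- The classes of `1`-extensions of `M` by `N`, for the equivalence relation generated by being
directly related (`Quot` passes to the generated equivalence relation). -/
def Ex1 : Type (u + 1) := Quot (OneExtension.DirectlyRelated (B := B) (M := M) (N := N))

variable (B M N) in
/-- The classes of `2`-extensions of `M` by `N`, for the equivalence relation generated by being
directly related. -/
def Ex2 : Type (u + 1) := Quot (TwoExtension.DirectlyRelated (B := B) (M := M) (N := N))

variable {L : Type u} [AddCommGroup L] [Module B L]

/-- The pushout `L ⊕_N T₁` of `f : N → L` and `N → T₁`. -/
abbrev TwoExtension.Pushout (ξ : TwoExtension B M N) (f : N →ₗ[B] L) : Type u :=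
  (L × ξ.T₁) ⧸ LinearMap.range (f.prod (-ξ.i))

/-- The `2`-extension `f_* ξ = (0 → L → L ⊕_N T₁ → T₀ → M → 0)`. -/
def TwoExtension.pushforward (ξ : TwoExtension B M N) (f : N →ₗ[B] L) : TwoExtension B M L where
  T₁ := ξ.Pushout f
  T₀ := ξ.T₀
  i := (LinearMap.range (f.prod (-ξ.i))).mkQ ∘ₗ LinearMap.inl B L ξ.T₁
  d := (LinearMap.range (f.prod (-ξ.i))).liftQ (ξ.d ∘ₗ LinearMap.snd B L ξ.T₁) (by
    rintro _ ⟨x, rfl⟩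
    simp [ξ.exact₁.apply_apply_eq_zero])
  p := ξ.p
  i_injective := by
    rw [injective_iff_map_eq_zero]
    intro l hl
    simp only [LinearMap.comp_apply, Submodule.mkQ_apply, Submodule.Quotient.mk_eq_zero] at hl
    obtain ⟨x, hx⟩ := hl
    have h₁ : f x = l := congrArg Prod.fst hx
    have h₂ : -ξ.i x = 0 := congrArg Prod.snd hx
    have : x = 0 := ξ.i_injective (by rw [neg_eq_zero.mp h₂, map_zero])
    rw [← h₁, this, map_zero]
  exact₁ := by
    intro y
    obtain ⟨⟨l, t⟩, rfl⟩ := Submodule.mkQ_surjective _ y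
    simp only [Submodule.mkQ_apply, Submodule.liftQ_apply, LinearMap.comp_apply,
      LinearMap.snd_apply]
    constructor
    · intro h
      obtain ⟨x, rfl⟩ := (ξ.exact₁ t).mp h
      refine ⟨l + f x, ?_⟩
      simp only [LinearMap.comp_apply, Submodule.mkQ_apply, LinearMap.inl_apply]
      rw [Submodule.Quotient.eq]
      exact ⟨x, by simp⟩
    · rintro ⟨l', h⟩
      simp only [LinearMap.comp_apply, Submodule.mkQ_apply, LinearMap.inl_apply] at h
      rw [Submodule.Quotient.eq] at h
      obtain ⟨x, hx⟩ := h
      have h₂ : -ξ.i x = 0 - t := congrArg Prod.snd hx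
      rw [zero_sub, neg_inj] at h₂
      rw [← h₂, ξ.exact₁.apply_apply_eq_zero]
  exact₀ := by
    intro y
    rw [ξ.exact₀ y]
    constructor
    · rintro ⟨t, rfl⟩
      exact ⟨Submodule.Quotient.mk (0, t), by simp⟩
    · rintro ⟨t, rfl⟩
      obtain ⟨⟨l, t⟩, rfl⟩ := Submodule.mkQ_surjective _ t
      exact ⟨t, by simp⟩
  p_surjective := ξ.p_surjective

/-- Pushforwards of two compatible extensions along compatible maps are directly related. -/
theorem TwoExtension.pushforward_directlyRelated {N' : Type u} [AddCommGroup N'] [Module B N']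
    (ξ : TwoExtension B M N) (ζ : TwoExtension B M N') (f : N →ₗ[B] L) (f' : N' →ₗ[B] L)
    (v : N →ₗ[B] N') (w₁ : ξ.T₁ →ₗ[B] ζ.T₁) (w₀ : ξ.T₀ →ₗ[B] ζ.T₀)
    (hf : ∀ x, f' (v x) = f x) (hi : ∀ x, w₁ (ξ.i x) = ζ.i (v x))
    (hd : ∀ x, ζ.d (w₁ x) = w₀ (ξ.d x)) (hp : ∀ x, ζ.p (w₀ x) = ξ.p x) :
    (ξ.pushforward f).DirectlyRelated (ζ.pushforward f') := by
  refine ⟨Submodule.mapQ _ _ (LinearMap.prodMap LinearMap.id w₁) ?_, w₀, ?_, ?_, ?_⟩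
  · rintro _ ⟨x, rfl⟩
    exact ⟨v x, by simp [hf, hi]⟩
  · apply LinearMap.ext
    intro l
    change Submodule.Quotient.mk (l, w₁ 0) = Submodule.Quotient.mk (l, 0)
    rw [map_zero]
  · apply LinearMap.ext
    intro y
    obtain ⟨⟨l, t⟩, rfl⟩ := Submodule.mkQ_surjective _ y
    exact hd t
  · exact LinearMap.ext hp

end Yoneda

/-! ### The connecting homomorphism and the basic construction -/

/-- An exact sequence `0 → K → F → N → 0` of `R`-modules with `F` projective. -/
structure ProjPresentation (R N : Type u) [CommRing R] [AddCommGroup N] [Module R N] where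
  K : Type u
  F : Type u
  [addCommGroupK : AddCommGroup K]
  [moduleK : Module R K]
  [addCommGroupF : AddCommGroup F]
  [moduleF : Module R F]
  [projective : Module.Projective R F]
  ι : K →ₗ[R] F
  π : F →ₗ[R] N
  ι_injective : Injective ι
  exact : Exact ι π
  π_surjective : Surjective π

attribute [instance] ProjPresentation.addCommGroupK ProjPresentation.moduleK
  ProjPresentation.addCommGroupF ProjPresentation.moduleF ProjPresentation.projective

/-- The presentation of `N` by the free module on the elements of `N`. -/
noncomputable def ProjPresentation.free (R N : Type u) [CommRing R] [AddCommGroup N]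
    [Module R N] : ProjPresentation R N where
  K := LinearMap.ker (Finsupp.linearCombination R (id : N → N))
  F := N →₀ R
  ι := (LinearMap.ker (Finsupp.linearCombination R (id : N → N))).subtype
  π := Finsupp.linearCombination R (id : N → N)
  ι_injective := Subtype.val_injective
  exact := LinearMap.exact_subtype_ker_map _
  π_surjective := fun n => ⟨Finsupp.single n 1, by simp⟩

section Connecting

variable {R B C N : Type u} [CommRing R] [CommRing B] [CommRing C] [Algebra R B] [Algebra B C]
  [Module R C] [IsScalarTower R B C] [AddCommGroup N] [Module C N] [Module B N] [Module R N]
  [IsScalarTower B C N] [IsScalarTower R B N]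

variable (R B N) in
/-- The canonical map `B ⊗_R N → N`, `b ⊗ n ↦ b n`. -/
noncomputable def actB : B ⊗[R] N →ₗ[B] N :=
  LinearMap.liftBaseChange B (LinearMap.id : N →ₗ[R] N)

theorem actB_injective (hRB : Surjective (algebraMap R B)) : Injective (actB R B N) := by
  have key : ∀ x : B ⊗[R] N, ∃ n : N, x = 1 ⊗ₜ n := by
    intro x
    induction x using TensorProduct.induction_on with
    | zero => exact ⟨0, by simp⟩
    | tmul b n =>
      obtain ⟨r, rfl⟩ := hRB b
      exact ⟨r • n, by rw [Algebra.algebraMap_eq_smul_one, smul_tmul]⟩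
    | add x y hx hy =>
      obtain ⟨m, rfl⟩ := hx
      obtain ⟨n, rfl⟩ := hy
      exact ⟨m + n, by rw [tmul_add]⟩
  rw [injective_iff_map_eq_zero]
  intro x hx
  obtain ⟨n, rfl⟩ := key x
  have : n = 0 := by simpa [actB] using hx
  rw [this, tmul_zero]

theorem actB_surjective : Surjective (actB R B N) := fun n => ⟨1 ⊗ₜ n, by simp [actB]⟩

variable (R B C N) in
/-- The canonical map `Tor_0^R(C, N) = C ⊗_R N → N`, `c ⊗ n ↦ c n`; it is an isomorphism when
`R → B → C` are surjective. -/
noncomputable def actC : C ⊗[R] N →ₗ[R] N :=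
  TensorProduct.lift (LinearMap.mk₂ R (fun (c : C) (n : N) => c • n)
    (fun a b n => add_smul a b n)
    (fun r c n => by
      rw [← algebraMap_smul B r c, ← algebraMap_smul B r (c • n), smul_assoc])
    (fun c a b => smul_add c a b)
    (fun r c n => by
      rw [← algebraMap_smul B r n, ← algebraMap_smul B r (c • n),
        ← algebraMap_smul C (algebraMap R B r) n, ← algebraMap_smul C (algebraMap R B r) (c • n),
        smul_comm]))

variable (B) in
/-- `Tor_1^R(B, N)`, computed from the presentation `0 → K → F → N → 0` with `F` projective: the
kernel of `B ⊗_R K → B ⊗_R F`. -/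
noncomputable def torOne (P : ProjPresentation R N) : Submodule B (B ⊗[R] P.K) :=
  LinearMap.ker (P.ι.baseChange B)

/-- The exact sequence `0 → Tor_1^R(B, N) → B ⊗_R K → B ⊗_R F → B ⊗_R N = N → 0`. -/
noncomputable def torExtension (P : ProjPresentation R N) (hRB : Surjective (algebraMap R B)) :
    TwoExtension B N (torOne B P) where
  T₁ := B ⊗[R] P.K
  T₀ := B ⊗[R] P.F
  i := (torOne B P).subtype
  d := P.ι.baseChange B
  p := actB R B N ∘ₗ P.π.baseChange B
  i_injective := Subtype.val_injective
  exact₁ := LinearMap.exact_subtype_ker_map _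
  exact₀ := by
    intro y
    have h : Exact (P.ι.lTensor B) (P.π.lTensor B) := lTensor_exact B P.exact P.π_surjective
    have h' : (actB R B N ∘ₗ P.π.baseChange B) y = 0 ↔ P.π.lTensor B y = 0 :=
      map_eq_zero_iff (actB R B N) (actB_injective hRB)
    rw [h']
    exact h y
  p_surjective :=
    actB_surjective.comp (LinearMap.lTensor_surjective B P.π_surjective)

/-- The connecting homomorphism `Tor_1^R(B, N) → Tor_0^R(C, N) = C ⊗_R N` attached to an extension
`0 → C → T → B → 0` of `R`-modules and to the functor `- ⊗_R N`: it is given by the snake lemma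
for the morphism from `C ⊗ K → T ⊗ K → B ⊗ K → 0` to `0 → C ⊗ F → T ⊗ F → B ⊗ F`. -/
noncomputable def connecting (ξ : OneExtension R B C) (P : ProjPresentation R N) :
    torOne B P →ₗ[R] C ⊗[R] N :=
  SnakeLemma.δ' (K₃ := torOne B P) (C₁ := C ⊗[R] N) (P.ι.lTensor C) (P.ι.lTensor ξ.T) (P.ι.lTensor B)
    (ξ.i.rTensor P.K) (ξ.p.rTensor P.K) (rTensor_exact P.K ξ.exact ξ.p_surjective)
    (ξ.i.rTensor P.F) (ξ.p.rTensor P.F) (rTensor_exact P.F ξ.exact ξ.p_surjective)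
    (by rw [LinearMap.rTensor_comp_lTensor, LinearMap.lTensor_comp_rTensor])
    (by rw [LinearMap.rTensor_comp_lTensor, LinearMap.lTensor_comp_rTensor])
    ((torOne B P).subtype.restrictScalars R)
    (LinearMap.exact_subtype_ker_map (P.ι.baseChange B))
    (P.π.lTensor C) (lTensor_exact C P.exact P.π_surjective)
    (LinearMap.rTensor_surjective P.K ξ.p_surjective)
    (Module.Flat.rTensor_preserves_injective_linearMap ξ.i ξ.i_injective)

/-- The map `∂ : Tor_1^R(B, N) → Tor_0^R(C, N) = N`; it is `B`-linear since `R → B` is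
surjective. -/
noncomputable def partialMap (ξ : OneExtension R B C) (P : ProjPresentation R N)
    (hRB : Surjective (algebraMap R B)) : torOne B P →ₗ[B] N where
  toFun x := actC R B C N (connecting ξ P x)
  map_add' x y := by rw [map_add, map_add]
  map_smul' b x := by
    obtain ⟨r, rfl⟩ := hRB b
    rw [RingHom.id_apply, algebraMap_smul, algebraMap_smul, map_smul, map_smul]

/-- The `2`-extension `∂_* (0 → Tor_1^R(B, N) → B ⊗_R K → B ⊗_R F → N → 0)` of `N` by `N`. -/
noncomputable def connectingExtension (ξ : OneExtension R B C) (P : ProjPresentation R N)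
    (hRB : Surjective (algebraMap R B)) : TwoExtension B N N :=
  (torExtension P hRB).pushforward (partialMap ξ P hRB)

theorem partialMap_eq (ξ : OneExtension R B C) (P : ProjPresentation R N)
    (hRB : Surjective (algebraMap R B)) (x : torOne B P) (y : ξ.T ⊗[R] P.K) (z : C ⊗[R] P.F)
    (hy : ξ.p.rTensor P.K y = x.1) (hz : ξ.i.rTensor P.F z = P.ι.lTensor ξ.T y) :
    partialMap ξ P hRB x = actC R B C N (P.π.lTensor C z) :=
  congrArg (actC R B C N) (SnakeLemma.δ'_eq _ _ _ _ _ _ _ _ _ _ _ _ _ _ _ _ _ x y hy z hz)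

theorem partialMap_exists (ξ : OneExtension R B C) (P : ProjPresentation R N) (x : torOne B P) :
    ∃ (y : ξ.T ⊗[R] P.K) (z : C ⊗[R] P.F),
      ξ.p.rTensor P.K y = x.1 ∧ ξ.i.rTensor P.F z = P.ι.lTensor ξ.T y := by
  obtain ⟨y, hy⟩ := LinearMap.rTensor_surjective P.K ξ.p_surjective x.1
  have h0 : ξ.p.rTensor P.F (P.ι.lTensor ξ.T y) = 0 := by
    rw [← LinearMap.comp_apply, LinearMap.rTensor_comp_lTensor, ← LinearMap.lTensor_comp_rTensor,
      LinearMap.comp_apply, hy]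
    exact x.2
  obtain ⟨z, hz⟩ := (rTensor_exact P.F ξ.exact ξ.p_surjective _).mp h0
  exact ⟨y, z, hy, hz⟩

/-- A morphism of presentations over a ring homomorphism. -/
theorem ProjPresentation.exists_lift {R' : Type u} [CommRing R'] [Module R' N] (σ : R →+* R')
    (hN : ∀ (r : R) (n : N), σ r • n = r • n)
    (P : ProjPresentation R N) (P' : ProjPresentation R' N) :
    ∃ (k : P.K →ₛₗ[σ] P'.K) (f : P.F →ₛₗ[σ] P'.F),
      (∀ x, P'.ι (k x) = f (P.ι x)) ∧ ∀ y, P'.π (f y) = P.π y := by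
  let : Module R P'.F := Module.compHom P'.F σ
  let π' : P'.F →ₗ[R] N :=
    { toFun := P'.π
      map_add' := map_add _
      map_smul' := fun r y => (map_smul P'.π (σ r) y).trans (hN r _) }
  obtain ⟨f, hf⟩ := Module.projective_lifting_property π' P.π P'.π_surjective
  have hf' : ∀ y, P'.π (f y) = P.π y := fun y => congrArg (fun g => g y) hf
  have hk : ∀ x, ∃ x', P'.ι x' = f (P.ι x) := fun x =>
    (P'.exact _).mp (by rw [hf', P.exact.apply_apply_eq_zero])
  choose k hk using hk
  refine ⟨{ toFun := k, map_add' := fun x y => P'.ι_injective ?_,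
            map_smul' := fun r x => P'.ι_injective ?_ },
    { toFun := f, map_add' := map_add f, map_smul' := fun r x => map_smul f r x }, hk, hf'⟩
  · rw [map_add, hk, hk, hk, map_add, map_add]
  · rw [hk, map_smul, map_smul, map_smul, hk]
    rfl

/-- The class of `connectingExtension` does not change under a ring homomorphism `R → R'` over `B`,
a compatible map of extensions, and a change of the projective presentation. -/
theorem connectingExtension_eq {R' : Type u} [CommRing R'] [Algebra R' B] [Module R' C]
    [IsScalarTower R' B C] [Module R' N] [IsScalarTower R' B N] (σ : R →+* R')
    (hσ : ∀ r, algebraMap R' B (σ r) = algebraMap R B r)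
    (hRB : Surjective (algebraMap R B)) (hRB' : Surjective (algebraMap R' B))
    (ξ : OneExtension R B C) (ξ' : OneExtension R' B C) (u : ξ.T →ₛₗ[σ] ξ'.T)
    (hi : ∀ c, u (ξ.i c) = ξ'.i c) (hp : ∀ t, ξ'.p (u t) = ξ.p t)
    (P : ProjPresentation R N) (P' : ProjPresentation R' N) :
    (Quot.mk _ (connectingExtension ξ P hRB) : Ex2 B N N) =
      Quot.mk _ (connectingExtension ξ' P' hRB') := by
  have hN : ∀ (r : R) (n : N), σ r • n = r • n := fun r n => by
    rw [← algebraMap_smul B (σ r) n, hσ, algebraMap_smul]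
  have hB : ∀ (r : R) (b : B), r • b = σ r • b := fun r b => by
    rw [Algebra.smul_def, Algebra.smul_def, hσ]
  have hC : ∀ (r : R) (c : C), r • c = σ r • c := fun r c => by
    rw [← algebraMap_smul B (σ r) c, hσ, algebraMap_smul]
  obtain ⟨k, f, hk, hf⟩ := P.exists_lift σ hN P'
  let idB : B →ₛₗ[σ] B := { toFun := id, map_add' := fun _ _ => rfl, map_smul' := hB }
  let idC : C →ₛₗ[σ] C := { toFun := id, map_add' := fun _ _ => rfl, map_smul' := hC }
  let w₁ : B ⊗[R] P.K →ₗ[B] B ⊗[R'] P'.K :=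
    { toFun := TensorProduct.map idB k
      map_add' := map_add _
      map_smul' := fun b x => by
        induction x using TensorProduct.induction_on with
        | zero => simp
        | tmul c y => rfl
        | add x y hx hy => rw [smul_add, map_add, hx, hy, map_add, smul_add] }
  let w₀ : B ⊗[R] P.F →ₗ[B] B ⊗[R'] P'.F :=
    { toFun := TensorProduct.map idB f
      map_add' := map_add _
      map_smul' := fun b x => by
        induction x using TensorProduct.induction_on with
        | zero => simp
        | tmul c y => rfl
        | add x y hx hy => rw [smul_add, map_add, hx, hy, map_add, smul_add] }
  have hd : ∀ x, P'.ι.baseChange B (w₁ x) = w₀ (P.ι.baseChange B x) := fun x => by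
    induction x using TensorProduct.induction_on with
    | zero => simp
    | tmul c y =>
      change c ⊗ₜ[R'] P'.ι (k y) = c ⊗ₜ[R'] f (P.ι y)
      rw [hk]
    | add x y hx hy => simp only [map_add, hx, hy]
  let v : torOne B P →ₗ[B] torOne B P' := w₁.restrict (fun x hx => by
    change P'.ι.baseChange B (w₁ x) = 0
    rw [hd, show P.ι.baseChange B x = 0 from hx, map_zero])
  refine Quot.sound (TwoExtension.pushforward_directlyRelated _ _ _ _ v w₁ w₀ ?_
    (fun _ => rfl) hd ?_)
  · intro x
    obtain ⟨y, z, hy, hz⟩ := partialMap_exists ξ P x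
    rw [partialMap_eq ξ P hRB x y z hy hz,
      partialMap_eq ξ' P' hRB' (v x) (TensorProduct.map u k y) (TensorProduct.map idC f z)]
    · clear hz
      induction z using TensorProduct.induction_on with
      | zero => simp
      | tmul c y =>
        change c • P'.π (f y) = c • P.π y
        rw [hf]
      | add x y hx hy => simp only [map_add, hx, hy]
    · change _ = w₁ x.1
      rw [← hy]
      clear hz hy
      induction y using TensorProduct.induction_on with
      | zero => simp
      | tmul c y =>
        change ξ'.p (u c) ⊗ₜ[R'] k y = ξ.p c ⊗ₜ[R'] k y
        rw [hp]
      | add x y hx hy => simp only [map_add, hx, hy]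
    · have h₁ : ξ'.i.rTensor P'.F (TensorProduct.map idC f z) =
          TensorProduct.map u f (ξ.i.rTensor P.F z) := by
        clear hz
        induction z using TensorProduct.induction_on with
        | zero => simp
        | tmul c y =>
          change ξ'.i c ⊗ₜ[R'] f y = u (ξ.i c) ⊗ₜ[R'] f y
          rw [hi]
        | add x y hx hy => simp only [map_add, hx, hy]
      rw [h₁, hz]
      clear hz hy h₁
      induction y using TensorProduct.induction_on with
      | zero => simp
      | tmul c y =>
        change u c ⊗ₜ[R'] f (P.ι y) = u c ⊗ₜ[R'] P'.ι (k y)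
        rw [hk]
      | add x y hx hy => simp only [map_add, hx, hy]
  · intro x
    change actB R' B N (P'.π.baseChange B (w₀ x)) = actB R B N (P.π.baseChange B x)
    induction x using TensorProduct.induction_on with
    | zero => simp
    | tmul c y =>
      simp only [actB, w₀, LinearMap.coe_mk, AddHom.coe_mk, TensorProduct.map_tmul,
        LinearMap.baseChange_tmul, LinearMap.liftBaseChange_tmul, LinearMap.id_apply, hf]
      rfl
    | add x y hx hy => simp only [map_add, hx, hy]

end Connecting

/-! ### Mehta's map -/

section Mehta

variable (R B C N : Type u) [CommRing R] [CommRing B] [CommRing C] [Algebra R B] [Algebra B C]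
  [Module R C] [IsScalarTower R B C] [AddCommGroup N] [Module C N] [Module B N] [Module R N]
  [IsScalarTower B C N] [IsScalarTower R B N]

/-- Mehta's map `φ : Ex¹_R(B, C) → Ex²_B(N, N)`, for `R → B` surjective. -/
noncomputable def mehtaMap (hRB : Surjective (algebraMap R B)) : Ex1 R B C → Ex2 B N N :=
  Quot.lift
    (fun ξ => Quot.mk _ (connectingExtension ξ (ProjPresentation.free R N) hRB))
    (fun ξ ζ ⟨w, hi, hp⟩ => connectingExtension_eq (RingHom.id R) (fun _ => rfl) hRB hRB ξ ζ w
      (fun c => LinearMap.congr_fun hi c) (fun t => LinearMap.congr_fun hp t) _ _)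

variable {R B C N}

/-- Mehta's map can be computed with any projective presentation of `N` over `R`. -/
theorem mehtaMap_mk (hRB : Surjective (algebraMap R B)) (ξ : OneExtension R B C)
    (P : ProjPresentation R N) :
    mehtaMap R B C N hRB (Quot.mk _ ξ) = Quot.mk _ (connectingExtension ξ P hRB) :=
  connectingExtension_eq (RingHom.id R) (fun _ => rfl) hRB hRB ξ ξ LinearMap.id
    (fun _ => rfl) (fun _ => rfl) _ _

end Mehta

/-! ### Infinitesimal extensions of algebras and the map `ψ` -/

/-- An infinitesimal extension `0 → M → E → B → 0` of the `A`-algebra `B` by the `B`-module `M`.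
The condition `mul_i` makes `i` an `A`-linear map and `i(M)` an ideal of square zero. -/
structure InfExtension (A B M : Type u) [CommRing A] [CommRing B] [Algebra A B]
    [AddCommGroup M] [Module B M] where
  E : Type u
  [commRing : CommRing E]
  [algebra : Algebra A E]
  i : M →+ E
  p : E →ₐ[A] B
  i_injective : Injective i
  exact : Exact i p
  p_surjective : Surjective p
  mul_i : ∀ (e : E) (m : M), e * i m = i (p e • m)

attribute [instance] InfExtension.commRing InfExtension.algebra

/-- Two infinitesimal extensions are equivalent if there is a homomorphism of `A`-algebras between
them which is the identity on both ends. -/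
def InfExtension.Equivalent {A B M : Type u} [CommRing A] [CommRing B] [Algebra A B]
    [AddCommGroup M] [Module B M] (η θ : InfExtension A B M) : Prop :=
  ∃ a : η.E →ₐ[A] θ.E, (∀ m, a (η.i m) = θ.i m) ∧ ∀ e, θ.p (a e) = η.p e

/-- The classes of infinitesimal extensions of `B` over `A` by `M`. -/
def Exal (A B M : Type u) [CommRing A] [CommRing B] [Algebra A B] [AddCommGroup M]
    [Module B M] : Type (u + 1) :=
  Quot (InfExtension.Equivalent (A := A) (B := B) (M := M))

namespace InfExtension

section Instances

variable {A B M : Type u} [CommRing A] [CommRing B] [Algebra A B] [AddCommGroup M] [Module B M]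

/-- `B` is an algebra over `E` through `p : E → B`. -/
instance baseAlgebra (η : InfExtension A B M) : Algebra η.E B := η.p.toRingHom.toAlgebra

/-- A `B`-module is an `E`-module through `p : E → B`. -/
abbrev moduleOfBase (η : InfExtension A B M) (N : Type u) [AddCommGroup N] [Module B N] :
    Module η.E N := Module.compHom N η.p.toRingHom

end Instances

variable {A B C : Type u} [CommRing A] [CommRing B] [CommRing C] [Algebra A B] [Algebra B C]

/-- The extension of `E`-modules `0 → C → E → B → 0` underlying an infinitesimal extension. -/
def toOneExtension (η : InfExtension A B C) :
    letI := η.moduleOfBase C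
    OneExtension η.E B C :=
  letI := η.moduleOfBase C
  { T := η.E
    i := { toFun := η.i, map_add' := map_add η.i, map_smul' := fun e c => (η.mul_i e c).symm }
    p := { toFun := η.p, map_add' := map_add η.p, map_smul' := fun e x => map_mul η.p e x }
    i_injective := η.i_injective
    exact := η.exact
    p_surjective := η.p_surjective }

variable {N : Type u} [AddCommGroup N] [Module C N] [Module B N] [IsScalarTower B C N]

/-- The `2`-extension `∂_* (0 → Tor_1^E(B, N) → B ⊗_E K → B ⊗_E F → N → 0)`, where `∂` is the
connecting homomorphism of `0 → C → E → B → 0`. -/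
noncomputable def psiExtension (η : InfExtension A B C)
    (P : letI := η.moduleOfBase N; ProjPresentation η.E N) : TwoExtension B N N :=
  letI := η.moduleOfBase C
  letI := η.moduleOfBase N
  haveI : IsScalarTower η.E B C := ⟨fun e b c => mul_smul (η.p e) b c⟩
  haveI : IsScalarTower η.E B N := ⟨fun e b n => mul_smul (η.p e) b n⟩
  connectingExtension η.toOneExtension P η.p_surjective

theorem psiExtension_eq (η θ : InfExtension A B C) (h : η.Equivalent θ)
    (P : letI := η.moduleOfBase N; ProjPresentation η.E N)
    (Q : letI := θ.moduleOfBase N; ProjPresentation θ.E N) :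
    (Quot.mk _ (η.psiExtension P) : Ex2 B N N) = Quot.mk _ (θ.psiExtension Q) := by
  let := η.moduleOfBase C
  let := η.moduleOfBase N
  have : IsScalarTower η.E B C := ⟨fun e b c => mul_smul (η.p e) b c⟩
  have : IsScalarTower η.E B N := ⟨fun e b n => mul_smul (η.p e) b n⟩
  let := θ.moduleOfBase C
  let := θ.moduleOfBase N
  have : IsScalarTower θ.E B C := ⟨fun e b c => mul_smul (θ.p e) b c⟩
  have : IsScalarTower θ.E B N := ⟨fun e b n => mul_smul (θ.p e) b n⟩
  obtain ⟨a, ha, hb⟩ := h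
  let w : η.E →ₛₗ[a.toRingHom] θ.E :=
    { toFun := a, map_add' := map_add a, map_smul' := fun e x => map_mul a e x }
  exact connectingExtension_eq a.toRingHom hb η.p_surjective θ.p_surjective
    η.toOneExtension θ.toOneExtension w ha hb P Q

end InfExtension

section Psi

variable (A B C N : Type u) [CommRing A] [CommRing B] [CommRing C] [Algebra A B] [Algebra B C]
  [AddCommGroup N] [Module C N] [Module B N] [IsScalarTower B C N]

/-- The map `ψ : Exal_A(B, C) → Ex²_B(N, N)`. -/
noncomputable def psiMap : Exal A B C → Ex2 B N N :=
  Quot.lift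
    (fun η => Quot.mk _ (η.psiExtension
      (letI := η.moduleOfBase N; ProjPresentation.free η.E N)))
    (fun η θ h => InfExtension.psiExtension_eq η θ h _ _)

variable {A B C N}

/-- The map `ψ` can be computed with any projective presentation of `N` over `E`. -/
theorem psiMap_mk (η : InfExtension A B C)
    (P : letI := η.moduleOfBase N; ProjPresentation η.E N) :
    psiMap A B C N (Quot.mk _ η) = Quot.mk _ (η.psiExtension P) :=
  InfExtension.psiExtension_eq η η ⟨AlgHom.id A η.E, fun _ => rfl, fun _ => rfl⟩ _ _

end Psi

/-! ### The Jacobi–Zariski map -/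

section JacobiZariski

variable {A R B M : Type u} [CommRing A] [CommRing R] [CommRing B] [Algebra R B] [AddCommGroup M]
  [Module B M] [Module R M] [IsScalarTower R B M]

theorem ker_smul (x : RingHom.ker (algebraMap R B)) (m : M) : (x : R) • m = 0 := by
  rw [← algebraMap_smul B (x : R) m, show algebraMap R B x = 0 from x.2, zero_smul]

theorem exists_i_eq (ξ : OneExtension R B M) (t : ξ.T) (ht : ξ.p t = 1)
    (x : RingHom.ker (algebraMap R B)) : ∃ m, ξ.i m = (x : R) • t :=
  (ξ.exact _).mp (by rw [map_smul, ht, ker_smul])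

/-- For an extension `0 → M → T → B → 0` and a lifting `f : R → T` of `R → B`, that is
`f r = r t` for an element `t` of `T` over `1`, the map `g : ker(R → B) → M` induced by `f`. -/
noncomputable def idealMap (ξ : OneExtension R B M) : RingHom.ker (algebraMap R B) →ₗ[R] M where
  toFun x := (exists_i_eq ξ _ (ξ.p_surjective 1).choose_spec x).choose
  map_add' x y := ξ.i_injective (by
    rw [map_add]
    simp only [(exists_i_eq ξ _ (ξ.p_surjective 1).choose_spec _).choose_spec]
    exact add_smul _ _ _)
  map_smul' r x := ξ.i_injective (by
    rw [map_smul]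
    simp only [(exists_i_eq ξ _ (ξ.p_surjective 1).choose_spec _).choose_spec]
    exact mul_smul _ _ _)

/-- The map `idealMap` does not depend on the lifting. -/
theorem i_idealMap (ξ : OneExtension R B M) (t : ξ.T) (ht : ξ.p t = 1)
    (x : RingHom.ker (algebraMap R B)) : ξ.i (idealMap ξ x) = (x : R) • t := by
  have h₀ := (ξ.p_surjective 1).choose_spec
  refine (exists_i_eq ξ _ h₀ x).choose_spec.trans ?_
  obtain ⟨m, hm⟩ := (ξ.exact (t - (ξ.p_surjective 1).choose)).mp (by rw [map_sub, ht, h₀, sub_self])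
  rw [← sub_eq_zero, ← neg_eq_zero, neg_sub, ← smul_sub, ← hm, ← map_smul, ker_smul, map_zero]

theorem idealMap_eq (ξ ζ : OneExtension R B M) (h : ξ.DirectlyRelated ζ) :
    idealMap ξ = idealMap ζ := by
  obtain ⟨w, hi, hp⟩ := h
  obtain ⟨t, ht⟩ := ξ.p_surjective 1
  refine LinearMap.ext fun x => ζ.i_injective ?_
  rw [i_idealMap ζ (w t) ((LinearMap.congr_fun hp t).trans ht), ← map_smul, ← i_idealMap ξ t ht]
  exact (LinearMap.congr_fun hi _).symm

variable (R M) in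
/-- The right action of `R` on `M` equal to the left one. -/
abbrev opModule : Module Rᵐᵒᵖ M := Module.compHom M ((RingHom.id R).fromOpposite mul_comm)

attribute [local instance] opModule in
theorem opCentral : IsCentralScalar R M := ⟨fun _ _ => rfl⟩

attribute [local instance] opModule opCentral

/-- The ideal of all `(-g x, x)`, `x ∈ ker(R → B)`, in the ring `M ⊕ R` with multiplication
`(m₁, r₁) (m₂, r₂) = (r₁ m₂ + r₂ m₁, r₁ r₂)`. -/
def pushIdeal (g : RingHom.ker (algebraMap R B) →ₗ[R] M) : Ideal (TrivSqZeroExt R M) where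
  carrier := {z | ∃ x : RingHom.ker (algebraMap R B), z.fst = x ∧ z.snd = -g x}
  zero_mem' := ⟨0, by simp⟩
  add_mem' := by
    rintro _ _ ⟨x, hx, hx'⟩ ⟨y, hy, hy'⟩
    exact ⟨x + y, by simp [hx, hy], by simp [hx', hy', add_comm]⟩
  smul_mem' := by
    rintro c z ⟨x, hx, hx'⟩
    refine ⟨c.fst • x, by simp [hx], ?_⟩
    rw [smul_eq_mul, TrivSqZeroExt.snd_mul, op_smul_eq_smul, hx, hx', ker_smul, add_zero, map_smul,
      smul_neg]

/-- The ring `M ⊕_I R`, for `I = ker(R → B)` and `g : I → M`. -/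
abbrev PushRing (g : RingHom.ker (algebraMap R B) →ₗ[R] M) : Type u :=
  TrivSqZeroExt R M ⧸ pushIdeal g

variable [Algebra A R] [Algebra A B] [IsScalarTower A R B]

/-- The `A`-algebra structure of `M ⊕_I R`, through `A → R`. -/
abbrev pushAlgebra (g : RingHom.ker (algebraMap R B) →ₗ[R] M) : Algebra A (PushRing g) :=
  ((Ideal.Quotient.mk (pushIdeal g)).comp
    ((TrivSqZeroExt.inlHom R M).comp (algebraMap A R))).toAlgebra

variable (A) in
/-- The infinitesimal extension `g_* (0 → I → R → B → 0) = (0 → M → M ⊕_I R → B → 0)` over `A`. -/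
noncomputable def pushExtension (hRB : Surjective (algebraMap R B))
    (g : RingHom.ker (algebraMap R B) →ₗ[R] M) : InfExtension A B M :=
  letI : Algebra A (PushRing g) := pushAlgebra g
  { E := PushRing g
    i := (Ideal.Quotient.mk (pushIdeal g)).toAddMonoidHom.comp
      (TrivSqZeroExt.inrHom R M).toAddMonoidHom
    p :=
      { toRingHom := Ideal.Quotient.lift (pushIdeal g)
          ((algebraMap R B).comp (TrivSqZeroExt.fstHom R R M).toRingHom) (by
            rintro z ⟨x, hx, -⟩
            change algebraMap R B z.fst = 0
            rw [hx]
            exact x.2)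
        commutes' := fun a => (IsScalarTower.algebraMap_apply A R B a).symm }
    i_injective := by
      rw [injective_iff_map_eq_zero]
      intro m hm
      obtain ⟨x, hx, hx'⟩ := Ideal.Quotient.eq_zero_iff_mem.mp hm
      have h0 : x = 0 := Subtype.ext hx.symm
      rw [h0, map_zero, neg_zero] at hx'
      exact hx'
    exact := by
      intro e
      obtain ⟨z, rfl⟩ := Ideal.Quotient.mk_surjective e
      constructor
      · intro h
        refine ⟨z.snd + g ⟨z.fst, h⟩, ?_⟩
        refine Ideal.Quotient.eq.mpr ⟨⟨-z.fst, neg_mem (show z.fst ∈ _ from h)⟩, ?_, ?_⟩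
        · change (0 : R) - z.fst = -z.fst
          rw [zero_sub]
        · change (z.snd + g ⟨z.fst, h⟩) - z.snd = _
          rw [show (⟨-z.fst, neg_mem (show z.fst ∈ _ from h)⟩ : RingHom.ker (algebraMap R B)) =
            -⟨z.fst, h⟩ from rfl, map_neg, neg_neg, add_sub_cancel_left]
      · rintro ⟨m, hm⟩
        rw [← hm]
        exact map_zero (algebraMap R B)
    p_surjective := fun b => by
      obtain ⟨r, rfl⟩ := hRB b
      exact ⟨Ideal.Quotient.mk _ (TrivSqZeroExt.inl r), rfl⟩
    mul_i := fun e m => by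
      obtain ⟨z, rfl⟩ := Ideal.Quotient.mk_surjective e
      change Ideal.Quotient.mk (pushIdeal g) (z * TrivSqZeroExt.inr m) =
        Ideal.Quotient.mk (pushIdeal g) (TrivSqZeroExt.inr (algebraMap R B z.fst • m))
      congr 1
      rw [algebraMap_smul]
      ext <;> simp }

variable (A R B M) in
/-- The Jacobi–Zariski map `α : Ex¹_R(B, M) → Exal_A(B, M)`, sending the class of
`0 → M → T → B → 0` to the class of `0 → M → M ⊕_I R → B → 0`. -/
noncomputable def jacobiZariski (hRB : Surjective (algebraMap R B)) : Ex1 R B M → Exal A B M :=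
  Quot.lift (fun ξ => Quot.mk _ (pushExtension A hRB (idealMap ξ)))
    (fun ξ ζ h => by rw [idealMap_eq ξ ζ h])

end JacobiZariski

end MehtaPsi

/-! The maps φ and ψ are the same construction over two different rings: take an extension of `B` by
`C` over a ring `S` mapping onto `B`, and push the Tor sequence of `N` over `S` out along the
connecting homomorphism. For φ the ring is `R`; for ψ it is the middle term `E`. By
`connectingExtension_eq`, the resulting class in `Ex2 B N N` is unchanged along a ring map over `B`
together with a compatible semilinear map of extensions, whatever projective presentations are used:
a lift between the presentations induces a map of Tor sequences that commutes with the connecting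
homomorphisms.

If `E` is an `R`-algebra, this applies to `R → E` and the identity of `E`, so ψ over `R` is φ after
forgetting the multiplication (`mehtaMap_forgetMul`). Forgetting is inverse to the Jacobi–Zariski
map over `R`: an extension `T` of `B` is recovered from `R` and any element over `1`, because that
element and `C` generate `T`, with relations given by `I → C`. Hence φ(x) = φ(forget(α x)) = ψ(α x)
with base `R`. Finally ψ depends only on the ring `E` over `B`, so the base `R` may be replaced by
`A`. -/

namespace MehtaPsi

/-! ### Forgetting the multiplication of an infinitesimal extension. -/

namespace InfExtension

variable {A B C : Type u} [CommRing A] [CommRing B] [Algebra A B] [AddCommGroup C] [Module B C]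
  [Module A C] [IsScalarTower A B C]

/-- The extension of `A`-modules underlying an infinitesimal extension of `A`-algebras. -/
def restrictBase (η : InfExtension A B C) : OneExtension A B C where
  T := η.E
  i :=
    { toFun := η.i
      map_add' := map_add η.i
      map_smul' := fun a c => by
        rw [RingHom.id_apply, Algebra.smul_def, η.mul_i, AlgHom.commutes, algebraMap_smul] }
  p := η.p.toLinearMap
  i_injective := η.i_injective
  exact := η.exact
  p_surjective := η.p_surjective

theorem restrictBase_directlyRelated {η θ : InfExtension A B C} (h : η.Equivalent θ) :
    η.restrictBase.DirectlyRelated θ.restrictBase := by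
  obtain ⟨a, hi, hp⟩ := h
  exact ⟨a.toLinearMap, LinearMap.ext hi, LinearMap.ext hp⟩

end InfExtension

/-! ### Module extensions and algebra extensions of a quotient of the base ring. -/

section Forget

variable (A B C : Type u) [CommRing A] [CommRing B] [Algebra A B] [AddCommGroup C] [Module B C]
  [Module A C] [IsScalarTower A B C]

/-- The map `Exal_A(B, C) → Ex¹_A(B, C)` forgetting the multiplication. -/
def forgetMul : Exal A B C → Ex1 A B C :=
  Quot.lift (fun η => Quot.mk _ η.restrictBase)
    (fun _ _ h => Quot.sound (InfExtension.restrictBase_directlyRelated h))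

variable {A B C}

attribute [local instance] opModule opCentral

/-- The ring extension `C ⊕_I A` attached to `ξ` is, as an extension of modules, directly related
to `ξ` through `(c, a) ↦ i c + a t`, where `t` lies over `1`. -/
theorem restrictBase_pushExtension_directlyRelated (hAB : Surjective (algebraMap A B))
    (ξ : OneExtension A B C) :
    (pushExtension A hAB (idealMap ξ)).restrictBase.DirectlyRelated ξ := by
  obtain ⟨t, ht⟩ := ξ.p_surjective 1
  -- The pushout is a quotient by an ideal of the ring `C ⊕ A`, so the map is first built on
  -- additive groups; linearity over `A` is checked after the descent.
  let v : TrivSqZeroExt A C →+ ξ.T :=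
    { toFun := fun z => ξ.i z.snd + z.fst • t
      map_zero' := by simp
      map_add' := fun y z => by
        rw [TrivSqZeroExt.snd_add, TrivSqZeroExt.fst_add, map_add, add_smul]
        abel }
  -- The relation `(-g x, x)` goes to `-i (g x) + x t`, which vanishes because `i (g x) = x t`
  -- characterises `g`, for any `t` over `1`.
  have hv : (pushIdeal (idealMap ξ)).toAddSubgroup ≤ v.ker := by
    rintro z ⟨x, hx, hx'⟩
    change ξ.i z.snd + z.fst • t = 0
    rw [hx, hx', map_neg, i_idealMap ξ t ht, neg_add_cancel]
  let w : PushRing (idealMap ξ) →+ ξ.T := QuotientAddGroup.lift _ v hv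
  refine ⟨{ toFun := w, map_add' := map_add w, map_smul' := ?_ }, ?_, ?_⟩
  · intro a e
    obtain ⟨z, rfl⟩ := Ideal.Quotient.mk_surjective e
    -- A scalar `a` acts on the pushout as multiplication by the class of `inl a`.
    change ξ.i (TrivSqZeroExt.inl a * z).snd + (TrivSqZeroExt.inl a * z).fst • t =
      a • (ξ.i z.snd + z.fst • t)
    simp [smul_add, mul_smul]
  · refine LinearMap.ext fun c => ?_
    change ξ.i c + (0 : A) • t = ξ.i c
    rw [zero_smul, add_zero]
  · refine LinearMap.ext fun e => ?_
    obtain ⟨z, rfl⟩ := Ideal.Quotient.mk_surjective e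
    change ξ.p (ξ.i z.snd + z.fst • t) = algebraMap A B z.fst
    rw [map_add, ξ.exact.apply_apply_eq_zero, zero_add, map_smul, ht, Algebra.smul_def, mul_one]

/-- In an algebra extension the unit of `E` is a preferred element over `1`, and the lifting it
defines is the structure map `A → E`. With this choice `(c, a) ↦ i c + a` is multiplicative, since
`i(C)` has square zero and `A` acts on it through `B`. -/
theorem pushExtension_restrictBase_equivalent (hAB : Surjective (algebraMap A B))
    (η : InfExtension A B C) :
    (pushExtension A hAB (idealMap η.restrictBase)).Equivalent η := by
  let v : TrivSqZeroExt A C →+* η.E :=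
    { toFun := fun z => algebraMap A η.E z.fst + η.i z.snd
      map_zero' := by simp
      map_one' := by simp
      map_add' := fun y z => by
        rw [TrivSqZeroExt.snd_add, TrivSqZeroExt.fst_add, map_add, map_add]
        abel
      map_mul' := fun y z => by
        have h0 : η.i y.snd * η.i z.snd = 0 := by
          rw [η.mul_i, η.exact.apply_apply_eq_zero, zero_smul, map_zero]
        have h (a : A) (c : C) : algebraMap A η.E a * η.i c = η.i (a • c) := by
          rw [η.mul_i, AlgHom.commutes, algebraMap_smul]
        rw [TrivSqZeroExt.snd_mul, TrivSqZeroExt.fst_mul, op_smul_eq_smul, map_mul, map_add,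
          ← h, ← h, add_mul, mul_add, mul_add, h0]
        ring }
  have hv : ∀ z ∈ pushIdeal (idealMap η.restrictBase), v z = 0 := by
    rintro z ⟨x, hx, hx'⟩
    -- `idealMap` was defined from an arbitrary element over `1`; its independence of that choice
    -- allows the unit here.
    have h : η.i (idealMap η.restrictBase x) = (x : A) • (1 : η.E) :=
      i_idealMap η.restrictBase (1 : η.E) (map_one η.p) x
    change algebraMap A η.E z.fst + η.i z.snd = 0
    rw [hx, hx', map_neg, h, Algebra.smul_def, mul_one, add_neg_cancel]
  let w : PushRing (idealMap η.restrictBase) →+* η.E := Ideal.Quotient.lift _ v hv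
  refine ⟨{ toRingHom := w, commutes' := ?_ }, ?_, ?_⟩
  · intro a
    change algebraMap A η.E a + η.i 0 = algebraMap A η.E a
    rw [map_zero, add_zero]
  · intro c
    change algebraMap A η.E 0 + η.i c = η.i c
    rw [map_zero, zero_add]
  · intro e
    obtain ⟨z, rfl⟩ := Ideal.Quotient.mk_surjective e
    change η.p (algebraMap A η.E z.fst + η.i z.snd) = algebraMap A B z.fst
    rw [map_add, AlgHom.commutes, η.exact.apply_apply_eq_zero, add_zero]

theorem forgetMul_jacobiZariski (hAB : Surjective (algebraMap A B)) (x : Ex1 A B C) :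
    forgetMul A B C (jacobiZariski A A B C hAB x) = x := by
  induction x using Quot.ind with
  | mk ξ => exact Quot.sound (restrictBase_pushExtension_directlyRelated hAB ξ)

theorem jacobiZariski_forgetMul (hAB : Surjective (algebraMap A B)) (x : Exal A B C) :
    jacobiZariski A A B C hAB (forgetMul A B C x) = x := by
  induction x using Quot.ind with
  | mk η => exact Quot.sound (pushExtension_restrictBase_equivalent hAB η)

theorem jacobiZariski_bijective (hAB : Surjective (algebraMap A B)) :
    Bijective (jacobiZariski A A B C hAB) :=
  bijective_iff_has_inverse.mpr
    ⟨forgetMul A B C, forgetMul_jacobiZariski hAB, jacobiZariski_forgetMul hAB⟩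

end Forget

/-! ### Comparison of Mehta's map with ψ. -/

section Comparison

variable {A R B C N : Type u} [CommRing R] [CommRing B] [CommRing C] [Algebra R B]
  [Algebra B C] [Module R C] [IsScalarTower R B C] [AddCommGroup N] [Module C N] [Module B N]
  [Module R N] [IsScalarTower B C N] [IsScalarTower R B N]

/-- For `R → B` surjective, `ψ` of an infinitesimal extension of `R`-algebras is Mehta's map of the
underlying extension of `R`-modules. -/
theorem mehtaMap_forgetMul (hRB : Surjective (algebraMap R B)) (x : Exal R B C) :
    mehtaMap R B C N hRB (forgetMul R B C x) = psiMap R B C N x := by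
  induction x using Quot.ind with
  | mk η =>
    let := η.moduleOfBase C
    let := η.moduleOfBase N
    have : IsScalarTower η.E B C := ⟨fun e b c => mul_smul (η.p e) b c⟩
    have : IsScalarTower η.E B N := ⟨fun e b n => mul_smul (η.p e) b n⟩
    -- The source is `E` as an `R`-module, the target `E` as a module over itself; the identity is
    -- semilinear along `R → E`.
    let u : η.E →ₛₗ[algebraMap R η.E] η.E :=
      { toFun := id, map_add' := fun _ _ => rfl, map_smul' := fun r e => Algebra.smul_def r e }
    exact connectingExtension_eq (algebraMap R η.E) η.p.commutes hRB η.p_surjective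
      η.restrictBase η.toOneExtension u (fun _ => rfl) (fun _ => rfl) _ _

/-- The base ring `A` plays no role in ψ, and the extension produced by α is already one of
`R`-algebras. Over the base `R`, surjectivity of `R → B` makes the forgetful map a left inverse of
α. -/
theorem mehtaMap_eq_psiMap_comp_jacobiZariski [CommRing A] [Algebra A R] [Algebra A B]
    [IsScalarTower A R B] (hRB : Surjective (algebraMap R B)) :
    mehtaMap R B C N hRB = psiMap A B C N ∘ jacobiZariski A R B C hRB := by
  funext x
  have h : psiMap R B C N (jacobiZariski R R B C hRB x) =
      psiMap A B C N (jacobiZariski A R B C hRB x) := by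
    induction x using Quot.ind with
    -- Both sides use the same ring `C ⊕_I R` with the same maps from `C` and to `B`; only the
    -- structure map from the base differs, and ψ ignores it.
    | mk ξ => rfl
  rw [comp_apply, ← h, ← mehtaMap_forgetMul hRB, forgetMul_jacobiZariski]

end Comparison

end MehtaPsi

theorem theorem3p5 {A R B C N : Type u} [CommRing A] [CommRing R] [CommRing B] [CommRing C]
    [Algebra A R] [Algebra A B] [Algebra R B] [Algebra B C] [Algebra A C] [Algebra R C]
    [IsScalarTower A R B] [IsScalarTower A B C] [IsScalarTower R B C]
    [AddCommGroup N] [Module C N] [Module B N] [Module R N] [Module A N]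
    [IsScalarTower B C N] [IsScalarTower R B N] [IsScalarTower A B N]
    (hRB : Function.Surjective (algebraMap R B)) (hBC : Function.Surjective (algebraMap B C)) :
    MehtaPsi.mehtaMap R B C N hRB =
        MehtaPsi.psiMap A B C N ∘ MehtaPsi.jacobiZariski A R B C hRB ∧
      ∀ hAB : Function.Surjective (algebraMap A B),
        Function.Bijective (MehtaPsi.jacobiZariski A A B C hAB) ∧
          MehtaPsi.mehtaMap A B C N hAB =
            MehtaPsi.psiMap A B C N ∘ MehtaPsi.jacobiZariski A A B C hAB :=
  ⟨MehtaPsi.mehtaMap_eq_psiMap_comp_jacobiZariski hRB, fun hAB =>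
    -- The second half is the case `R = A`, where α is the inverse of forgetting the multiplication.
    ⟨MehtaPsi.jacobiZariski_bijective hAB,
      MehtaPsi.mehtaMap_eq_psiMap_comp_jacobiZariski hAB⟩⟩
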